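/- Let $U$ be a finite set and let $\mathcal L\subseteq\{-1,0,+1\}^U$ be a nonempty system of sign vectors that is simple: $\{X_e : X\in\mathcal L\}=\{-1,0,+1\}$ for every $e\in U$, and for all $e\ne f$ in $U$ there are $X,Y\in\mathcal L$ with $\{X_eX_f,\,Y_eY_f\}=\{+1,-1\}$. Write $X\circ Y$ for the composition ($(X\circ Y)_e=X_e$ if $X_e\neq 0$ and $(X\circ Y)_e=Y_e$ otherwise), $S(X,Y)=\{e: X_eY_e=-1\}$ for the separator, and order sign vectors coordinatewise by $0\le -1$, $0\le +1$ (with $-1$ and $+1$ incomparable). Consider the following axioms. - (C) $X\circ Y\in\mathcal L$ for all $X,Y\in\mathcal L$. - (SE) For all $X,Y\in\mathcal L$ and $e\in S(X,Y)$ there is $Z\in\mathcal L$ with $Z_e=0$ and $Z_f=(X\circ Y)_f$ for all $f\notin S(X,Y)$. - (Sym) $-\mathcal L=\mathcal L$. - (FS) $X\circ(-Y)\in\mathcal L$ for all $X,Y\in\mathcal L$. - (IC) If $X\in\mathcal L$ and $X\le Y\in\{-1,0,+1\}^U$, then $Y\in\mathcal L$. $\mathcal L$ is an oriented matroid (OM)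 if it satisfies (C), (SE), (Sym); a complex of oriented matroids (COM) if it satisfies (SE), (FS); and an ample system (AMP) if it is a COM satisfying (IC). The topes of a system of sign vectors are its maximal elements; each tope $T$ is identified with the subset $\{e : T_e=+1\}$ of $U$, and the tope graph $G$ of $\mathcal L$ is the subgraph of the hypercube $Q(U)$ on $2^U$ induced by the topes. The VC-dimension of an induced subgraph of $Q(U)$ is the largest size of a subset of $U$ shattered by the family of its vertices. The face of $X\in\mathcal L$ is $F(X)=\{X\circ Y: Y\in\mathcal L\}$, and its VC-dimension is that of the subgraph of $Q(U)$ induced by the topes of $F(X)$. The rank of an OM $\mathcal L$ is the length of the maximal chains of the poset obtained from $(\mathcal L,\le)$ by adding an artificial global maximum, minus one. Then: 1. If $\mathcal L$ is an OM, the VC-dimension of $G$ equals the rank of $\mathcal L$. 2. If $\mathcal L$ is a COM, the VC-dimension of $G$ equals the maximum of the VC-dimensions of the faces $F(X)$, $X\in\mathcal L$. 3. If $\mathcal L$ is an AMP, the VC-dimension of $G$ equals the largest dimension $|X|$ of a cube $\{Y\cup X' : X'\subseteq X\}$ (with $X\subseteq U$ and $Y\subseteq U\setminus X$) contained in $G$.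 -/

import Mathlib

/-- Sign vectors on the ground set `U`: maps from `U` to `{-1, 0, +1}`. They form a type of their
own because the order of `SignType` (in which `-1 < 0 < 1`) is not the one used here. -/
@[ext]
structure SignVector (U : Type*) where
  /-- The sign of an element of the ground set. -/
  sign : U → SignType

namespace SignVector

variable {U : Type*}

instance : CoeFun (SignVector U) (fun _ => U → SignType) := ⟨SignVector.sign⟩

/-- The product ordering relative to the ordering of signs with `0 ≤ -1` and `0 ≤ +1`
(and `-1`, `+1` incomparable). -/
instance : PartialOrder (SignVector U) where
  le X Y := ∀ e, X e = 0 ∨ X e = Y e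
  le_refl _ _ := Or.inr rfl
  le_trans X Y Z h₁ h₂ e := by
    rcases h₁ e with h | h
    · exact Or.inl h
    · rw [h]; exact h₂ e
  le_antisymm X Y h₁ h₂ := by
    ext1
    funext e
    rcases h₁ e with h | h
    · rcases h₂ e with h' | h'
      · rw [h, h']
      · exact h'.symm
    · exact h

/-- The sign reversal `-X`. -/
def opp (X : SignVector U) : SignVector U := ⟨fun e => -X e⟩

/-- The composition `X ∘ Y`: equal to `X e` where `X e ≠ 0`, and to `Y e` elsewhere. -/
def comp (X Y : SignVector U) : SignVector U := ⟨fun e => if X e = 0 then Y e else X e⟩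

/-- The separator `S(X, Y)`. -/
def separator (X Y : SignVector U) : Set U := {e | X e * Y e = -1}

end SignVector

namespace SignSystem

variable {U : Type*}

/-- Axiom (C), composition. -/
def Composition (L : Set (SignVector U)) : Prop :=
  ∀ X ∈ L, ∀ Y ∈ L, X.comp Y ∈ L

/-- Axiom (SE), strong elimination. -/
def StrongElimination (L : Set (SignVector U)) : Prop :=
  ∀ X ∈ L, ∀ Y ∈ L, ∀ e ∈ X.separator Y,
    ∃ Z ∈ L, Z e = 0 ∧ ∀ f, f ∉ X.separator Y → Z f = X.comp Y f

/-- Axiom (Sym), symmetry: `-L = L`. -/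
def Symmetry (L : Set (SignVector U)) : Prop :=
  SignVector.opp '' L = L

/-- Axiom (FS), face symmetry. -/
def FaceSymmetry (L : Set (SignVector U)) : Prop :=
  ∀ X ∈ L, ∀ Y ∈ L, X.comp Y.opp ∈ L

/-- The set `↑L` of all sign vectors that lie above some member of `L`. -/
def up (L : Set (SignVector U)) : Set (SignVector U) :=
  {Y | ∃ X ∈ L, X ≤ Y}

/-- Axiom (IC), ideal composition. -/
def IdealComposition (L : Set (SignVector U)) : Prop := up L = L

/-- Simple systems of sign vectors: no redundant elements. -/
structure IsSimple (L : Set (SignVector U)) : Prop where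
  all_signs : ∀ e : U, {s : SignType | ∃ X ∈ L, X e = s} = {1, -1, 0}
  separated : ∀ e f : U, e ≠ f →
    ∃ X ∈ L, ∃ Y ∈ L, ({X e * X f, Y e * Y f} : Set SignType) = {1, -1}

/-- Oriented matroids, given by their covectors. -/
structure IsOM (L : Set (SignVector U)) : Prop where
  nonempty : L.Nonempty
  composition : Composition L
  strongElimination : StrongElimination L
  symmetry : Symmetry L

/-- Complexes of oriented matroids. -/
structure IsCOM (L : Set (SignVector U)) : Prop where
  nonempty : L.Nonempty
  strongElimination : StrongElimination L
  faceSymmetry : FaceSymmetry L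

/-- Ample systems. -/
structure IsAMP (L : Set (SignVector U)) : Prop where
  isCOM : IsCOM L
  idealComposition : IdealComposition L

/-- The face `F(X) = {X ∘ Y : Y ∈ L}` of a covector `X`. -/
def face (L : Set (SignVector U)) (X : SignVector U) : Set (SignVector U) :=
  {Z | ∃ Y ∈ L, X.comp Y = Z}

/-- The poset of covectors together with an artificial global maximum. -/
abbrev BigFaceLattice (L : Set (SignVector U)) : Type _ := WithTop L

/-- The rank: the length (number of steps) of the longest chains of the big face lattice,
minus one. For an oriented matroid on a finite set all maximal chains have this length. -/
noncomputable def rank (L : Set (SignVector U)) : ℕ :=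
  ((Order.krullDim (BigFaceLattice L)).unbotD 0).toNat - 1

/-- The topes of `L`: its maximal members. -/
def topes (L : Set (SignVector U)) : Set (SignVector U) := {T | Maximal (· ∈ L) T}

variable [Fintype U] [DecidableEq U]

/-- The subset of `U` encoded by a tope: the elements where it is `+`. -/
def positivePart (T : SignVector U) : Finset U := Finset.univ.filter fun e => T e = 1

/-- The topes of `L` as a family of subsets of `U`. -/
def topeFamily (L : Set (SignVector U)) : Set (Finset U) := positivePart '' topes L

end SignSystem

namespace Hypercube

variable {U : Type*} [DecidableEq U]

/-- The hypercube `Q(U)`: two subsets of `U` are adjacent when they differ in one element. -/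
def graph (U : Type*) [DecidableEq U] : SimpleGraph (Finset U) where
  Adj A B := (symmDiff A B).card = 1
  symm := ⟨fun A B h => by rwa [symmDiff_comm]⟩
  loopless := ⟨fun A h => by simp at h⟩

/-- The 1-inclusion graph of a set family: the subgraph of the hypercube that it induces. -/
def oneInclusionGraph (S : Set (Finset U)) : (graph U).Subgraph :=
  (⊤ : (graph U).Subgraph).induce S

/-- The VC-dimension of a subgraph of the hypercube: that of the set family of its vertices. -/
noncomputable def vcDim [Fintype U] (G : (graph U).Subgraph) : ℕ :=
  (Set.toFinite G.verts).toFinset.vcDim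

/-- The `X`-cube `{Y ∪ X' : X' ⊆ X}` of the hypercube (used for `Y` disjoint from `X`). -/
def cube (X Y : Finset U) : (graph U).Subgraph :=
  oneInclusionGraph {A | ∃ X', X' ⊆ X ∧ A = Y ∪ X'}

/-- `G` contains a cube of dimension `k`. -/
def ContainsCube (G : (graph U).Subgraph) (k : ℕ) : Prop :=
  ∃ X Y : Finset U, Disjoint Y X ∧ X.card = k ∧ cube X Y ≤ G

end Hypercube

namespace SignSystem

/-- The tope graph of `L`: the 1-inclusion graph of its topes. -/
def topeGraph {U : Type*} [Fintype U] [DecidableEq U] (L : Set (SignVector U)) :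
    (Hypercube.graph U).Subgraph :=
  Hypercube.oneInclusionGraph (topeFamily L)

end SignSystem

/-! Everything is read off from the sets `A` on which `L` realizes all nowhere zero patterns.
Composition puts a full covector above each covector, so topes are the full members and these `A`
are exactly the shattered sets (`shatters_topeFamily_iff`). Strong elimination then creates zeros
(`RealizesSigns.exists_eq`), so some covector `X` vanishes on `A`.

In a COM, the face of `X` still shatters `A`. In an ample system, the zeros of `X` can be filled
freely, which gives a cube on `A`. In an OM, filling `A` one coordinate at a time gives a chain with
`A.card` steps; conversely, picking a newly nonzero coordinate at each step of a chain gives a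
shattered set, by symmetry. -/

namespace SignVector

variable {U : Type*}

/-- A sign vector without zeros. -/
def IsFull (X : SignVector U) : Prop := ∀ e, X e ≠ 0

lemma comp_apply (X Y : SignVector U) (e : U) : X.comp Y e = if X e = 0 then Y e else X e := rfl

lemma opp_apply (X : SignVector U) (e : U) : X.opp e = -X e := rfl

lemma comp_apply_of_eq_zero {X : SignVector U} {e : U} (h : X e = 0) (Y : SignVector U) :
    X.comp Y e = Y e := if_pos h

lemma comp_apply_of_ne_zero {X : SignVector U} {e : U} (h : X e ≠ 0) (Y : SignVector U) :
    X.comp Y e = X e := if_neg h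

lemma le_comp (X Y : SignVector U) : X ≤ X.comp Y := fun e => by
  by_cases h : X e = 0
  · exact Or.inl h
  · exact Or.inr (comp_apply_of_ne_zero h Y).symm

lemma comp_eq_of_le {X Y : SignVector U} (h : X ≤ Y) : X.comp Y = Y := by
  ext1
  funext e
  by_cases he : X e = 0
  · exact comp_apply_of_eq_zero he Y
  · exact (comp_apply_of_ne_zero he Y).trans ((h e).resolve_left he)

lemma IsFull.comp_left {Y : SignVector U} (hY : Y.IsFull) (X : SignVector U) :
    (X.comp Y).IsFull := fun e => by
  rw [comp_apply]
  split_ifs with h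
  · exact hY e
  · exact h

lemma IsFull.eq_of_le {X Y : SignVector U} (hX : X.IsFull) (h : X ≤ Y) : X = Y :=
  SignVector.ext (funext fun e => (h e).resolve_left (hX e))

end SignVector

namespace SignSystem

open SignVector

variable {U : Type*} {L : Set (SignVector U)}

/-! ### Realized patterns, and topes as covectors without zeros -/

/-- `L` realizes every nowhere zero sign pattern on `A`. -/
def RealizesSigns (L : Set (SignVector U)) (A : Finset U) : Prop :=
  ∀ s : U → SignType, (∀ e, s e ≠ 0) → ∃ Z ∈ L, ∀ e ∈ A, Z e = s e

/-- Every member of `L` lies below a member without zeros. -/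
def HasFullCovers (L : Set (SignVector U)) : Prop :=
  ∀ X ∈ L, ∃ T ∈ L, X ≤ T ∧ T.IsFull

lemma mem_topes_iff (hL : HasFullCovers L) {T : SignVector U} :
    T ∈ topes L ↔ T ∈ L ∧ T.IsFull := by
  refine ⟨fun h => ⟨h.prop, ?_⟩, fun h => ⟨h.1, fun Y _ hTY => (h.2.eq_of_le hTY).ge⟩⟩
  obtain ⟨T', hT', hle, hfull⟩ := hL T h.prop
  exact (h.eq_of_le hT' hle) ▸ hfull

/-- Face symmetry applied twice: the two sign changes cancel where `X` vanishes. -/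
lemma IsCOM.composition (h : IsCOM L) : Composition L := fun X hX Y hY => by
  convert h.faceSymmetry X hX _ (h.faceSymmetry X hX Y hY) using 1
  ext1
  funext e
  by_cases he : X e = 0
  · simp only [comp_apply_of_eq_zero he, opp_apply, neg_neg]
  · simp only [comp_apply_of_ne_zero he]

lemma IsOM.opp_mem (h : IsOM L) {X : SignVector U} (hX : X ∈ L) : X.opp ∈ L :=
  h.symmetry ▸ Set.mem_image_of_mem opp hX

lemma IsSimple.exists_ne_zero (h : IsSimple L) (e : U) : ∃ X ∈ L, X e ≠ 0 := by
  have h1 : (1 : SignType) ∈ {s : SignType | ∃ X ∈ L, X e = s} := by simp [h.all_signs e]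
  obtain ⟨X, hX, hXe⟩ := h1
  exact ⟨X, hX, by simp [hXe]⟩

lemma Composition.exists_isFull [Finite U] (hC : Composition L) (hne : L.Nonempty)
    (h : ∀ e, ∃ X ∈ L, X e ≠ 0) : ∃ T ∈ L, T.IsFull := by
  classical
  cases nonempty_fintype U
  suffices H : ∀ B : Finset U, ∃ T ∈ L, ∀ e ∈ B, T e ≠ 0 by
    obtain ⟨T, hT, hB⟩ := H Finset.univ
    exact ⟨T, hT, fun e => hB e (Finset.mem_univ e)⟩
  intro B
  induction B using Finset.induction_on with
  | empty => exact hne.imp fun X hX => ⟨hX, by simp⟩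
  | insert a B _ ih =>
    obtain ⟨T, hT, hB⟩ := ih
    obtain ⟨X, hX, hXa⟩ := h a
    refine ⟨T.comp X, hC T hT X hX, fun e he => ?_⟩
    rw [comp_apply]
    split_ifs with h0
    · rcases Finset.mem_insert.1 he with rfl | he
      · exact hXa
      · exact absurd h0 (hB e he)
    · exact h0

lemma Composition.hasFullCovers (hC : Composition L) (h : ∃ T ∈ L, T.IsFull) :
    HasFullCovers L := fun X hX => by
  obtain ⟨T, hT, hfull⟩ := h
  exact ⟨X.comp T, hC X hX T hT, le_comp X T, hfull.comp_left X⟩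

lemma IsSimple.hasFullCovers [Finite U] (h : IsSimple L) (hne : L.Nonempty)
    (hC : Composition L) : HasFullCovers L :=
  hC.hasFullCovers (hC.exists_isFull hne h.exists_ne_zero)

lemma face_subset (hC : Composition L) {X : SignVector U} (hX : X ∈ L) : face L X ⊆ L := by
  rintro _ ⟨Y, hY, rfl⟩
  exact hC X hX Y hY

lemma mem_face_of_le {X Y : SignVector U} (hY : Y ∈ L) (h : X ≤ Y) : Y ∈ face L X :=
  ⟨Y, hY, comp_eq_of_le h⟩

lemma HasFullCovers.face (hL : HasFullCovers L) (hC : Composition L) {X : SignVector U}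
    (hX : X ∈ L) : HasFullCovers (face L X) := by
  rintro _ ⟨Y, hY, rfl⟩
  obtain ⟨T, hT, hle, hfull⟩ := hL _ (hC X hX Y hY)
  exact ⟨T, mem_face_of_le hT ((le_comp X Y).trans hle), hle, hfull⟩

/-! ### Patterns with zeros, chains and rank -/

/-- Strong elimination turns all nowhere zero patterns on `A` into all patterns on `A`. -/
lemma RealizesSigns.exists_eq [DecidableEq U] {A : Finset U} (hA : RealizesSigns L A)
    (hSE : StrongElimination L) (s : U → SignType) : ∃ Z ∈ L, ∀ e ∈ A, Z e = s e := by
  -- `B` collects the coordinates where the pattern may be zero.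
  suffices H : ∀ B : Finset U, B ⊆ A → ∀ s : U → SignType, (∀ e ∈ A, e ∉ B → s e ≠ 0) →
      ∃ Z ∈ L, ∀ e ∈ A, Z e = s e from
    H A subset_rfl s fun e he h => absurd he h
  intro B
  induction B using Finset.induction_on with
  | empty =>
    intro _ s hs
    -- Off `A` the value 1 is a dummy: realized patterns must be nonzero everywhere.
    obtain ⟨Z, hZ, h⟩ := hA (fun e => if e ∈ A then s e else 1) fun e => by
      split_ifs with he
      · exact hs e he (by simp)
      · decide
    exact ⟨Z, hZ, fun e he => by simp [h e he, he]⟩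
  | insert a B ha ih =>
    intro hB s hs
    have haA : a ∈ A := hB (Finset.mem_insert_self a B)
    have key : ∀ t : SignType, t ≠ 0 → ∃ Z ∈ L, ∀ e ∈ A, Z e = Function.update s a t e := by
      intro t ht
      refine ih ((Finset.subset_insert a B).trans hB) _ fun e he heB => ?_
      by_cases hea : e = a
      · subst hea; simpa using ht
      · simpa [hea] using hs e he (by simp [hea, heB])
    by_cases hsa : s a = 0
    · obtain ⟨X, hX, hXs⟩ := key 1 (by decide)
      obtain ⟨Y, hY, hYs⟩ := key (-1) (by decide)
      have hXa := hXs a haA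
      have hYa := hYs a haA
      rw [Function.update_self] at hXa hYa
      obtain ⟨Z, hZ, hZa, hZs⟩ := hSE X hX Y hY a (by simp [separator, hXa, hYa])
      refine ⟨Z, hZ, fun e he => ?_⟩
      by_cases hea : e = a
      · subst hea; rw [hZa, hsa]
      -- On `A` the covectors `X` and `Y` differ only at `a`, so elimination keeps their common
      -- value here.
      · have hXe := hXs e he
        have hYe := hYs e he
        rw [Function.update_of_ne hea] at hXe hYe
        rw [hZs e, comp_apply, hXe, hYe, ite_self]
        rw [separator, Set.mem_ofPred_eq, hXe, hYe]
        cases s e <;> decide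
    · obtain ⟨Z, hZ, h⟩ := key (s a) hsa
      exact ⟨Z, hZ, by simpa using h⟩

lemma RealizesSigns.exists_eq_zero [DecidableEq U] {A : Finset U} (hA : RealizesSigns L A)
    (hSE : StrongElimination L) : ∃ X ∈ L, ∀ e ∈ A, X e = 0 :=
  hA.exists_eq hSE fun _ => 0

lemma RealizesSigns.mono {M : Set (SignVector U)} {A : Finset U} (hA : RealizesSigns L A)
    (h : L ⊆ M) : RealizesSigns M A := fun s hs => by
  obtain ⟨Z, hZ, hZs⟩ := hA s hs
  exact ⟨Z, h hZ, hZs⟩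

lemma RealizesSigns.face {A : Finset U} (hA : RealizesSigns L A) {X : SignVector U}
    (hX : ∀ e ∈ A, X e = 0) : RealizesSigns (face L X) A := fun s hs => by
  obtain ⟨Z, hZ, hZs⟩ := hA s hs
  exact ⟨X.comp Z, ⟨Z, hZ, rfl⟩, fun e he => by
    rw [comp_apply_of_eq_zero (hX e he), hZs e he]⟩

/-- Start from a covector that vanishes on `A` and compose with covectors that are unit vectors on
`A`: each composition is a strict step up. -/
lemma RealizesSigns.card_le_krullDim [DecidableEq U] {A : Finset U} (hA : RealizesSigns L A)
    (hC : Composition L) (hSE : StrongElimination L) :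
    ((A.card : ℕ∞) : WithBot ℕ∞) ≤ Order.krullDim L := by
  suffices H : ∀ B : Finset U, B ⊆ A → ∃ Y : L,
      (∀ e ∈ A, e ∉ B → Y.1 e = 0) ∧ (B.card : ℕ∞) ≤ Order.height Y by
    obtain ⟨Y, -, hY⟩ := H A subset_rfl
    exact (WithBot.coe_le_coe.2 hY).trans (Order.height_le_krullDim Y)
  intro B
  induction B using Finset.induction_on with
  | empty =>
    intro _
    obtain ⟨X, hX, h⟩ := hA.exists_eq_zero hSE
    exact ⟨⟨X, hX⟩, fun e he _ => h e he, by simp⟩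
  | insert a B ha ih =>
    intro hB
    have haA : a ∈ A := hB (Finset.mem_insert_self a B)
    obtain ⟨⟨Y, hY⟩, hY0, hYB⟩ := ih ((Finset.subset_insert a B).trans hB)
    obtain ⟨X, hX, hXs⟩ := hA.exists_eq hSE (Pi.single a 1)
    have hlt : (⟨Y, hY⟩ : L) < ⟨Y.comp X, hC Y hY X hX⟩ := by
      refine lt_of_le_of_ne (le_comp Y X) fun h => ?_
      have hYa : Y a = 0 := hY0 a haA ha
      have h1 : Y a = Y.comp X a := congrArg (fun Z : L => Z.1 a) h
      rw [comp_apply_of_eq_zero hYa, hXs a haA, hYa, Pi.single_eq_same] at h1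
      exact absurd h1 (by decide)
    refine ⟨⟨Y.comp X, hC Y hY X hX⟩, fun e he heB => ?_, ?_⟩
    · rw [Finset.mem_insert, not_or] at heB
      change Y.comp X e = 0
      rw [comp_apply_of_eq_zero (hY0 e he heB.2), hXs e he, Pi.single_eq_of_ne heB.1]
    · rw [Finset.card_insert_of_notMem ha, Nat.cast_add, Nat.cast_one]
      exact (add_le_add_left hYB 1).trans (Order.height_add_one_le hlt)

/-- In an oriented matroid, a covector of height at least `n` supports an `n`-set on which all
nowhere zero patterns are realized. -/
lemma IsOM.exists_realizesSigns_of_le_height [DecidableEq U] (h : IsOM L) (n : ℕ) :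
    ∀ X : L, (n : ℕ∞) ≤ Order.height X → ∃ A : Finset U, A.card = n ∧ (∀ e ∈ A, X.1 e ≠ 0) ∧
      ∀ s : U → SignType, (∀ e, s e ≠ 0) →
        ∃ Z ∈ L, (∀ e, X.1 e = 0 → Z e = 0) ∧ ∀ e ∈ A, Z e = s e := by
  induction n with
  | zero =>
    intro X _
    exact ⟨∅, rfl, by simp, fun _ _ => ⟨X.1, X.2, fun _ h => h, by simp⟩⟩
  | succ n ih =>
    intro X hX
    obtain ⟨Y, hYX, hY⟩ : ∃ Y < X, (n : ℕ∞) ≤ Order.height Y := by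
      by_contra! hcon
      have h1 := hX.trans (Order.height_le_coe_iff.2 hcon)
      exact absurd (Nat.cast_le.1 h1) (by omega)
    obtain ⟨A, hAn, hAY, hA⟩ := ih Y hY
    have hle : Y.1 ≤ X.1 := hYX.le
    obtain ⟨a, ha0, haX⟩ : ∃ a, Y.1 a = 0 ∧ X.1 a ≠ 0 := by
      by_contra! hcon
      refine hYX.not_ge fun e => ?_
      rcases hle e with he | he
      · exact Or.inl (hcon e he)
      · exact Or.inr he.symm
    have haA : a ∉ A := fun ha => hAY a ha ha0
    refine ⟨insert a A, by rw [Finset.card_insert_of_notMem haA, hAn], ?_, fun s hs => ?_⟩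
    · intro e he
      rcases Finset.mem_insert.1 he with rfl | he
      · exact haX
      · exact (hle e).resolve_left (hAY e he) ▸ hAY e he
    · obtain ⟨Z, hZ, hZ0, hZs⟩ := hA s hs
      -- `W` is `X` or its opposite. Since `Z` vanishes wherever `Y` does, in particular at `a`,
      -- composing with `W` sets the sign at `a` and leaves `A` alone.
      obtain ⟨W, hW, hW0, hWa⟩ : ∃ W ∈ L, (∀ e, X.1 e = 0 → W e = 0) ∧ W a = s a := by
        by_cases hXs : X.1 a = s a
        · exact ⟨X.1, X.2, fun _ h => h, hXs⟩
        · refine ⟨X.1.opp, h.opp_mem X.2, fun e he => by simp [opp_apply, he], ?_⟩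
          rw [opp_apply]
          have hsa := hs a
          revert hXs hsa haX
          generalize X.1 a = x
          generalize s a = y
          revert x y
          decide
      refine ⟨Z.comp W, h.composition Z hZ W hW, fun e he => ?_, fun e he => ?_⟩
      · rw [comp_apply_of_eq_zero (hZ0 e ?_), hW0 e he]
        rcases hle e with h' | h'
        · exact h'
        · rw [h', he]
      · rcases Finset.mem_insert.1 he with rfl | he
        · rw [comp_apply_of_eq_zero (hZ0 e ha0), hWa]
        · rw [comp_apply_of_ne_zero, hZs e he]
          rw [hZs e he]
          exact hs e

/-- The artificial maximum adds one to the dimension, and the subtraction in `rank` removes it. -/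
lemma rank_eq_of_krullDim_eq (hne : L.Nonempty) {n : ℕ}
    (h : Order.krullDim L = ((n : ℕ∞) : WithBot ℕ∞)) : rank L = n := by
  have := hne.to_subtype
  rw [rank, Order.krullDim_WithTop, h]
  have h1 : (((n : ℕ∞) : WithBot ℕ∞) + 1) = (((n + 1 : ℕ) : ℕ∞) : WithBot ℕ∞) := by
    push_cast; rfl
  rw [h1, WithBot.unbotD_coe, ENat.toNat_natCast, Nat.add_sub_cancel]

lemma mem_positivePart [Fintype U] {T : SignVector U} {e : U} : e ∈ positivePart T ↔ T e = 1 := by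
  simp [positivePart]

/-! ### VC-dimension of tope graphs -/

section Fintype

variable [Fintype U] [DecidableEq U]

/-- A full vector is determined by its positive part. A covector realizing a pattern may have zeros
off `A`, but a tope above it keeps the pattern. -/
lemma shatters_topeFamily_iff (hL : HasFullCovers L) {A : Finset U} :
    (Set.toFinite (topeGraph L).verts).toFinset.Shatters A ↔ RealizesSigns L A := by
  have hmem (B : Finset U) : B ∈ (Set.toFinite (topeGraph L).verts).toFinset ↔
      ∃ T ∈ L, T.IsFull ∧ positivePart T = B := by
    rw [Set.Finite.mem_toFinset]
    change B ∈ positivePart '' topes L ↔ _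
    simp only [Set.mem_image, mem_topes_iff hL, and_assoc]
  constructor
  · intro h s hs
    obtain ⟨B, hB, hAB⟩ := h (Finset.filter_subset (fun e => s e = 1) A)
    obtain ⟨T, hT, hfull, rfl⟩ := (hmem B).1 hB
    refine ⟨T, hT, fun e he => ?_⟩
    have h1 : T e = 1 ↔ s e = 1 := by
      have := Finset.ext_iff.1 hAB e
      simpa [he, mem_positivePart] using this
    have h2 := hs e
    have h3 := hfull e
    revert h1 h2 h3
    generalize T e = x
    generalize s e = y
    revert x y
    decide
  · intro h B hB
    obtain ⟨Z, hZ, hZs⟩ := h (fun e => if e ∈ B then 1 else -1) fun e => by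
      split_ifs <;> decide
    obtain ⟨T, hT, hle, hfull⟩ := hL Z hZ
    refine ⟨positivePart T, (hmem _).2 ⟨T, hT, hfull, rfl⟩, ?_⟩
    ext e
    rw [Finset.mem_inter, mem_positivePart]
    constructor
    · rintro ⟨he, hTe⟩
      by_contra heB
      have hZe : Z e = -1 := by rw [hZs e he, if_neg heB]
      have h1 := (hle e).resolve_left (by rw [hZe]; decide)
      rw [hZe, hTe] at h1
      exact absurd h1 (by decide)
    · intro heB
      have hZe : Z e = 1 := by rw [hZs e (hB heB), if_pos heB]
      exact ⟨hB heB, ((hle e).resolve_left (by rw [hZe]; decide)).symm.trans hZe⟩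

lemma RealizesSigns.card_le_vcDim (hL : HasFullCovers L) {A : Finset U}
    (hA : RealizesSigns L A) : A.card ≤ Hypercube.vcDim (topeGraph L) :=
  ((shatters_topeFamily_iff hL).2 hA).card_le_vcDim

lemma exists_realizesSigns_card_eq_vcDim (hL : HasFullCovers L) (hne : L.Nonempty) :
    ∃ A : Finset U, RealizesSigns L A ∧ A.card = Hypercube.vcDim (topeGraph L) := by
  -- The empty set is shattered, so the supremum is attained.
  have hempty : RealizesSigns L ∅ := fun _ _ => hne.imp fun X hX => ⟨hX, by simp⟩
  obtain ⟨A, hA, hcard⟩ := Finset.exists_mem_eq_sup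
    (Set.toFinite (topeGraph L).verts).toFinset.shatterer
    ⟨∅, Finset.mem_shatterer.2 ((shatters_topeFamily_iff hL).2 hempty)⟩ Finset.card
  exact ⟨A, (shatters_topeFamily_iff hL).1 (Finset.mem_shatterer.1 hA), hcard.symm⟩

lemma IsOM.vcDim_topeGraph (h : IsOM L) (hL : HasFullCovers L) :
    Hypercube.vcDim (topeGraph L) = rank L := by
  symm
  apply rank_eq_of_krullDim_eq h.nonempty
  apply le_antisymm
  · rw [Order.krullDim_eq_iSup_height]
    -- Heights could a priori be infinite, so each finite lower bound `n` is compared instead.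
    refine iSup_le fun X => WithBot.coe_le_coe.2 (ENat.forall_natCast_le_iff_le.1 fun n hn => ?_)
    obtain ⟨A, rfl, -, hA⟩ := h.exists_realizesSigns_of_le_height n X hn
    refine Nat.cast_le.2 (RealizesSigns.card_le_vcDim hL fun s hs => ?_)
    obtain ⟨Z, hZ, -, hZs⟩ := hA s hs
    exact ⟨Z, hZ, hZs⟩
  · obtain ⟨A, hA, hcard⟩ := exists_realizesSigns_card_eq_vcDim hL h.nonempty
    rw [← hcard]
    exact hA.card_le_krullDim h.composition h.strongElimination

/-- Faces lie in `L`, so they shatter no more. If `X` vanishes on a largest shattered set, composing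
with `X` preserves every pattern there. -/
lemma IsCOM.isGreatest_vcDim_face (h : IsCOM L) (hL : HasFullCovers L) :
    IsGreatest {d : ℕ | ∃ X ∈ L, Hypercube.vcDim (topeGraph (face L X)) = d}
      (Hypercube.vcDim (topeGraph L)) := by
  have hle : ∀ X ∈ L,
      Hypercube.vcDim (topeGraph (face L X)) ≤ Hypercube.vcDim (topeGraph L) := by
    intro X hX
    obtain ⟨A, hA, hcard⟩ := exists_realizesSigns_card_eq_vcDim (hL.face h.composition hX)
      ⟨_, X, hX, rfl⟩
    rw [← hcard]
    exact (hA.mono (face_subset h.composition hX)).card_le_vcDim hL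
  refine ⟨?_, ?_⟩
  · obtain ⟨A, hA, hcard⟩ := exists_realizesSigns_card_eq_vcDim hL h.nonempty
    obtain ⟨X, hX, hX0⟩ := hA.exists_eq_zero h.strongElimination
    refine ⟨X, hX, (hle X hX).antisymm ?_⟩
    rw [← hcard]
    exact (hA.face hX0).card_le_vcDim (hL.face h.composition hX)
  · rintro _ ⟨X, hX, rfl⟩
    exact hle X hX

lemma IsAMP.isGreatest_containsCube (h : IsAMP L) (hL : HasFullCovers L) :
    IsGreatest {k : ℕ | Hypercube.ContainsCube (topeGraph L) k}
      (Hypercube.vcDim (topeGraph L)) := by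
  refine ⟨?_, ?_⟩
  · obtain ⟨A, hA, hcard⟩ := exists_realizesSigns_card_eq_vcDim hL h.isCOM.nonempty
    obtain ⟨X, hX, hX0⟩ := hA.exists_eq_zero h.isCOM.strongElimination
    refine ⟨A, Finset.univ.filter fun e => X e = 1, ?_, hcard,
      SimpleGraph.Subgraph.induce_mono_right ?_⟩
    · rw [Finset.disjoint_left]
      intro e he heA
      simp [hX0 e heA] at he
    · rintro _ ⟨A', hA', rfl⟩
      -- Zeros of `X` outside `A'`, including those off `A`, become negative, so the positive part
      -- is exactly that of `X` together with `A'`.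
      let T : SignVector U :=
        ⟨fun e => if X e = 0 then (if e ∈ A' then 1 else -1) else X e⟩
      have hXT : X ≤ T := fun e => by
        by_cases he : X e = 0
        · exact Or.inl he
        · exact Or.inr (if_neg he).symm
      have hT : T ∈ L := h.idealComposition ▸ (⟨X, hX, hXT⟩ : T ∈ up L)
      have hfull : T.IsFull := fun e => by
        dsimp only [T]
        split_ifs with h1 h2
        · decide
        · decide
        · exact h1
      refine ⟨T, (mem_topes_iff hL).2 ⟨hT, hfull⟩, ?_⟩
      ext e
      simp only [mem_positivePart, Finset.mem_union, Finset.mem_filter, Finset.mem_univ, true_and]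
      dsimp only [T]
      by_cases he : X e = 0
      · by_cases heA : e ∈ A' <;> simp [he, heA]
      · have heA : e ∉ A' := fun h' => he (hX0 e (hA' h'))
        simp [he, heA]
  · rintro _ ⟨A, B, hdisj, rfl, hcube⟩
    refine Finset.Shatters.card_le_vcDim fun A' hA' => ?_
    -- The base `B` misses `A`, so this vertex of the cube has trace `A'` on `A`.
    refine ⟨B ∪ A', (Set.Finite.mem_toFinset _).2 (hcube.1 ⟨A', hA', rfl⟩), ?_⟩
    rw [Finset.inter_union_distrib_left, Finset.disjoint_iff_inter_eq_empty.1 hdisj.symm, Finset.empty_union,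
      Finset.inter_eq_right.2 hA']

end Fintype

end SignSystem

theorem mainTheorem9 {U : Type*} [Fintype U] [DecidableEq U]
    (L : Set (SignVector U)) (hL : SignSystem.IsSimple L) :
    (SignSystem.IsOM L →
      Hypercube.vcDim (SignSystem.topeGraph L) = SignSystem.rank L) ∧
    (SignSystem.IsCOM L →
      IsGreatest {d : ℕ | ∃ X ∈ L,
          Hypercube.vcDim (SignSystem.topeGraph (SignSystem.face L X)) = d}
        (Hypercube.vcDim (SignSystem.topeGraph L))) ∧
    (SignSystem.IsAMP L →
      IsGreatest {k : ℕ | Hypercube.ContainsCube (SignSystem.topeGraph L) k}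
        (Hypercube.vcDim (SignSystem.topeGraph L))) := by
  exact ⟨fun h => h.vcDim_topeGraph (hL.hasFullCovers h.nonempty h.composition),
    fun h => h.isGreatest_vcDim_face (hL.hasFullCovers h.nonempty h.composition),
    fun h => h.isGreatest_containsCube (hL.hasFullCovers h.isCOM.nonempty h.isCOM.composition)⟩
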